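/- For $n\ge 1$ let $\mathcal Q_{n+1}$ be the set of permutation-invariant probability distributions $Q$ of $n+1$ binary random variables $Y_1,\dots,Y_{n+1}\in\{0,1\}$. For $0\le\lambda<1$ let $U_1,\dots,U_n\in\{0,1\}$ be conditionally independent given $Y_1,\dots,Y_{n+1}$, where $U_i=0$ if $Y_i=0$, and $U_i=0$ (resp. $U_i=1$) with probability $\lambda$ (resp. $1-\lambda$) if $Y_i=1$; put $L=\sum_{i=1}^n U_i$. For integers $n>l\ge 0$ and $0<\delta<1$ define the upper confidence limit $$\overline{\epsilon}_\lambda(l,n,\delta)=\max_{Q\in\mathcal Q_{n+1}}\{Q(Y_{n+1}=1\mid L\le l)\;:\;Q(L\le l)\ge\delta\},$$ and for $0<\epsilon<1$ put $$N_{\lambda,\mathrm c}(l,\epsilon,\delta)=\min\{n\ge l+1\;:\;\overline{\epsilon}_\lambda(l,n,\delta)\le\epsilon\}.$$ **Lemma.** Fix an integer $k_0\ge 0$. (1) For every fixed $0<\lambda<1$, with $\nu=1-\lambda$, $$\lim_{\delta,\epsilon\to 0^+}\frac{\epsilon\,N_{\lambda,\mathrm c}(\lceil\nu k_0\rceil,\epsilon,\delta)}{\ln\delta^{-1}}=\frac{1}{\lambda\ln\lambda^{-1}},$$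 both as a joint limit and as an iterated limit in either order: the limit as $\delta\to0^+$ exists for each fixed $\epsilon\in(0,1)$ and converges to the right-hand side as $\epsilon\to0^+$, and the limit as $\epsilon\to0^+$ exists for each fixed $\delta\in(0,1)$ and converges to the right-hand side as $\delta\to0^+$. (2) Consequently $\lambda=1/e$ is the optimal choice: for $0<\lambda<1$ one has $\frac{1}{\lambda\ln\lambda^{-1}}\ge e$, with equality if and only if $\lambda=1/e$; and for every fixed $\lambda\in(0,1)$ with $\lambda\ne 1/e$, one has $N_{1/e,\mathrm c}(\lceil(1-1/e)k_0\rceil,\epsilon,\delta)<N_{\lambda,\mathrm c}(\lceil(1-\lambda)k_0\rceil,\epsilon,\delta)$ for all sufficiently small $\epsilon,\delta>0$. -/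

import Mathlib

open Filter Topology Set

noncomputable section

namespace RandomizedTest

/-- The set `𝒬_m` of permutation invariant probability distributions of `m` binary variables
`Y_1, …, Y_m`; a distribution is given by its mass function, and `true` stands for the outcome `1`
(a "failure"), `false` for the outcome `0` (a "success"). -/
def exchangeable (m : ℕ) : Set ((Fin m → Bool) → ℝ) :=
  {Q | Q ∈ stdSimplex ℝ (Fin m → Bool) ∧
    ∀ (σ : Equiv.Perm (Fin m)) (y : Fin m → Bool), Q (y ∘ σ) = Q y}

/-- The transition probability `P_{U_i | Y_i}(u | y)` of the artificial noise with
randomization parameter `lam`: a success is kept, and a failure is turned into a success with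
probability `lam`. The first argument is `y`, the second one is `u`. -/
def noise (lam : ℝ) : Bool → Bool → ℝ
  | false, false => 1
  | false, true => 0
  | true, false => lam
  | true, true => 1 - lam

/-- The outcomes of all variables `(Y_1, …, Y_{n+1})` and `(U_1, …, U_n)`. -/
abbrev Outcome (n : ℕ) : Type := (Fin (n + 1) → Bool) × (Fin n → Bool)

/-- The joint mass function of `(Y_1, …, Y_{n+1})` and `(U_1, …, U_n)`: the vector `Y` has the
distribution `Q`, and given `Y` each `U_i`, `1 ≤ i ≤ n`, is obtained from `Y_i` by the noise,
independently for different `i`. -/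
def joint (lam : ℝ) {n : ℕ} (Q : (Fin (n + 1) → Bool) → ℝ) (w : Outcome n) : ℝ :=
  Q w.1 * ∏ i : Fin n, noise lam (w.1 i.castSucc) (w.2 i)

/-- The probability of an event under the joint distribution. -/
def prob (lam : ℝ) {n : ℕ} (Q : (Fin (n + 1) → Bool) → ℝ) (E : Set (Outcome n)) : ℝ :=
  ∑ w : Outcome n, E.indicator (joint lam Q) w

/-- The conditional probability of `E` given `F` under the joint distribution. -/
def condProb (lam : ℝ) {n : ℕ} (Q : (Fin (n + 1) → Bool) → ℝ) (E F : Set (Outcome n)) : ℝ :=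
  prob lam Q (E ∩ F) / prob lam Q F

/-- The event `L ≤ l`, where `L` is the number of failures among `U_1, …, U_n`. -/
def accept (l n : ℕ) : Set (Outcome n) :=
  {w | (Finset.univ.filter fun i : Fin n => w.2 i = true).card ≤ l}

/-- The event `Y_{n+1} = 1`. -/
def lastFails (n : ℕ) : Set (Outcome n) :=
  {w | w.1 (Fin.last n) = true}

/-- The upper confidence limit `max {Q(Y_{n+1} = 1 | L ≤ l) : Q ∈ 𝒬_{n+1}, Q(L ≤ l) ≥ δ}`.
For `0 < δ ≤ 1` this is a supremum of a continuous function over a nonempty compact set, so that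
it is attained. -/
def upperConfidenceLimit (lam : ℝ) (l n : ℕ) (δ : ℝ) : ℝ :=
  sSup {x | ∃ Q ∈ exchangeable (n + 1),
    δ ≤ prob lam Q (accept l n) ∧ x = condProb lam Q (lastFails n) (accept l n)}

/-- The minimum number `N_{λ,c}(l, ε, δ)` of observations, with `l` allowed failures, that
guarantees the upper confidence limit `ε` under the significance level `δ`. -/
def minObservations (lam : ℝ) (l : ℕ) (ε δ : ℝ) : ℕ :=
  sInf {n : ℕ | l + 1 ≤ n ∧ upperConfidenceLimit lam l n δ ≤ ε}

/-- `N_{λ,c}(⌈(1 - λ) k₀⌉, ε, δ)`, the number of observations needed in the constant regime. -/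
def constRegimeN (lam : ℝ) (k₀ : ℕ) (ε δ : ℝ) : ℕ :=
  minObservations lam ⌈(1 - lam) * (k₀ : ℝ)⌉₊ ε δ

/-- The normalized number of observations
`ε N_{λ,c}(⌈(1 - λ) k₀⌉, ε, δ) / ln δ⁻¹`. -/
def normalizedN (lam : ℝ) (k₀ : ℕ) (ε δ : ℝ) : ℝ :=
  ε * (constRegimeN lam k₀ ε δ : ℝ) / Real.log δ⁻¹

end RandomizedTest

end

/-! By exchangeability `Q` matters only through the law of the number `k` of ones among `Y_1, …,
Y_{n+1}`. The confidence limit is then a linear-fractional program over laws on `{0, …, n+1}`, with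
weights built from the binomial tail `binomTail`, i.e. `lam ^ k` up to a polynomial factor.

As `δ → 0`, the largest `k` still accepted with probability `δ` is about `K = ln δ⁻¹ / ln lam⁻¹`.
Consecutive tails have ratio close to `lam`, so a count `k` has posterior failure probability `ε`
when `k` is about `(n+1) ε / slope lam ε`. Equating the two gives `N ≈ K * slope lam ε / ε`. A point
mass gives the lower bound (`le_of_upperConfidenceLimit_le`), a dual certificate the upper one
(`exists_upperConfidenceLimit_le`). The errors are uniform in `ε`, and `slope lam ε → 1 / lam`; this
yields the joint limit and the iterated limit with `δ → 0` inside.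

For fixed `δ`, `(n+1)` times the confidence limit is bounded and almost nondecreasing in `n`
(`upperConfidenceLimit_transfer`), so it converges, and hence so does `ε N`. The joint limit then
determines the outer limit.

With `q = ln lam⁻¹` the value is `e * exp (q - 1) / q`, and `exp (q - 1) ≥ q` with equality only at
`q = 1`. A strict inequality between limits gives the strict comparison of the numbers of
observations. -/

noncomputable section

namespace RandomizedTest
-- Reduction to mixtures over the number of failures
/-- The probability that a binomial variable with `k` trials and success probability `1 - lam`
is smaller than `m`. -/
def binomTail (lam : ℝ) : ℕ → ℕ → ℝ
  | 0, _ => 0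
  | _ + 1, 0 => 1
  | m + 1, k + 1 => lam * binomTail lam (m + 1) k + (1 - lam) * binomTail lam m k

/-- The number of coordinates with value `true`. -/
def ones {n : ℕ} (y : Fin n → Bool) : ℕ :=
  (Finset.univ.filter fun i : Fin n => y i = true).card

lemma ones_eq_sum {n : ℕ} (y : Fin n → Bool) :
    ones y = ∑ i, if y i = true then 1 else 0 := by
  simp [ones]

lemma ones_cons {n : ℕ} (b : Bool) (u : Fin n → Bool) :
    ones (Fin.cons b u : Fin (n + 1) → Bool) = (if b = true then 1 else 0) + ones u := by
  rw [ones_eq_sum, ones_eq_sum, Fin.sum_univ_succ]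
  simp

lemma ones_castSucc {n : ℕ} (y : Fin (n + 1) → Bool) :
    ones y = ones (fun i : Fin n => y i.castSucc) + if y (Fin.last n) = true then 1 else 0 := by
  rw [ones_eq_sum, ones_eq_sum, Fin.sum_univ_castSucc]

lemma ones_comp_perm {n : ℕ} (y : Fin n → Bool) (σ : Equiv.Perm (Fin n)) :
    ones (y ∘ σ) = ones y := by
  rw [ones_eq_sum, ones_eq_sum]
  exact Equiv.sum_comp σ (fun i => if y i = true then 1 else 0)

lemma ones_le {n : ℕ} (y : Fin n → Bool) : ones y ≤ n := by
  simpa [ones] using Finset.card_le_univ (Finset.univ.filter fun i : Fin n => y i = true)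

lemma exists_ones_eq {n k : ℕ} (hk : k ≤ n) : ∃ y : Fin n → Bool, ones y = k := by
  refine ⟨fun i => decide ((i : ℕ) < k), ?_⟩
  simp only [ones, decide_eq_true_eq]
  rw [Fin.card_filter_val_lt]
  omega

/-- Condition on the first coordinate: a success changes nothing, and a failure uses up one unit of
`m` exactly when the noise keeps it. -/
lemma sum_noise_eq_binomTail (lam : ℝ) {n : ℕ} (y : Fin n → Bool) (m : ℕ) :
    (∑ u : Fin n → Bool, if ones u < m then ∏ i, noise lam (y i) (u i) else 0) =
      binomTail lam m (ones y) := by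
  induction n generalizing m with
  | zero =>
    cases m with
    | zero => simp [binomTail]
    | succ m => simp [binomTail, ones]
  | succ n ih =>
    have hc : ∀ (b : Bool) (u : Fin n → Bool),
        Fin.consEquiv (fun _ => Bool) (b, u) = (Fin.cons b u : Fin (n + 1) → Bool) :=
      fun _ _ => rfl
    rw [← (Fin.consEquiv (fun _ => Bool)).sum_comp, Fintype.sum_prod_type, Fintype.sum_bool,
      ← Fin.cons_self_tail y]
    simp only [hc, ones_cons, Fin.prod_univ_succ, Fin.cons_zero, Fin.cons_succ]
    cases y 0 with
    | false =>
      rw [show noise lam false true = 0 from rfl, show noise lam false false = 1 from rfl]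
      simpa using ih (Fin.tail y) m
    | true =>
      rw [show noise lam true true = 1 - lam from rfl, show noise lam true false = lam from rfl]
      cases m with
      | zero => simp [binomTail]
      | succ m =>
        simp only [if_true, Bool.false_eq_true, if_false, zero_add, add_comm 1,
          Nat.add_lt_add_iff_right]
        rw [binomTail, ← ih (Fin.tail y) m, ← ih (Fin.tail y) (m + 1), Finset.mul_sum,
          Finset.mul_sum, add_comm]
        simp only [mul_ite, mul_zero]

lemma prob_inter_accept (lam : ℝ) {n : ℕ} (l : ℕ) (Q : (Fin (n + 1) → Bool) → ℝ)
    (E : Set (Fin (n + 1) → Bool)) :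
    prob lam Q ({w | w.1 ∈ E} ∩ accept l n) =
      ∑ y, E.indicator Q y * binomTail lam (l + 1) (ones fun i : Fin n => y i.castSucc) := by
  classical
  rw [prob, Fintype.sum_prod_type]
  refine Finset.sum_congr rfl fun y _ => ?_
  rw [← sum_noise_eq_binomTail, Finset.mul_sum]
  refine Finset.sum_congr rfl fun u _ => ?_
  by_cases hy : y ∈ E <;> by_cases hu : ones u < l + 1
  · rw [indicator_of_mem (show (y, u) ∈ {w : Outcome n | w.1 ∈ E} ∩ accept l n from
        ⟨hy, Nat.lt_succ_iff.mp hu⟩),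
      indicator_of_mem hy, if_pos hu, joint]
  · rw [indicator_of_notMem (fun h => hu (Nat.lt_succ_of_le h.2)), if_neg hu, mul_zero]
  · rw [indicator_of_notMem (fun h => hy h.1), indicator_of_notMem hy, zero_mul]
  · rw [indicator_of_notMem (fun h => hy h.1), indicator_of_notMem hy, zero_mul]

/-- Under an exchangeable distribution, given the number of ones, the last variable is one with
probability proportional to that number. -/
lemma sum_last_eq {n : ℕ} {Q : (Fin (n + 1) → Bool) → ℝ} (hQ : Q ∈ exchangeable (n + 1))
    (F : ℕ → ℝ) :
    (∑ y, if y (Fin.last n) = true then Q y * F (ones y) else 0) =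
      ∑ y, Q y * ((ones y : ℝ) / (n + 1) * F (ones y)) := by
  -- Swapping `i` with the last index shows that every coordinate contributes equally; summing over
  -- `i` then counts each `y` exactly `ones y` times.
  have key : ∀ i : Fin (n + 1), (∑ y, if y i = true then Q y * F (ones y) else 0) =
      ∑ y, if y (Fin.last n) = true then Q y * F (ones y) else 0 := by
    intro i
    rw [← ((Equiv.swap i (Fin.last n)).arrowCongr (Equiv.refl Bool)).sum_comp]
    refine Finset.sum_congr rfl fun y _ => ?_
    have : ((Equiv.swap i (Fin.last n)).arrowCongr (Equiv.refl Bool)) y =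
        y ∘ (Equiv.swap i (Fin.last n)) := by
      ext j; simp [Equiv.arrowCongr]
    rw [this, hQ.2, ones_comp_perm]
    simp
  have hsum : (∑ i : Fin (n + 1), ∑ y, if y i = true then Q y * F (ones y) else 0) =
      ∑ y, Q y * ((ones y : ℝ) * F (ones y)) := by
    rw [Finset.sum_comm]
    refine Finset.sum_congr rfl fun y _ => ?_
    rw [← Finset.sum_filter, Finset.sum_const, nsmul_eq_mul]
    rw [← ones]; ring
  rw [Finset.sum_congr rfl fun i _ => key i, Finset.sum_const, nsmul_eq_mul] at hsum
  simp only [Finset.card_univ, Fintype.card_fin] at hsum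
  have hn : ((n + 1 : ℕ) : ℝ) ≠ 0 := by positivity
  rw [← mul_right_inj' hn, hsum, Finset.mul_sum]
  refine Finset.sum_congr rfl fun y _ => ?_
  push_cast
  field_simp

/-- The probability that `Y_{n+1} = 1` and `L ≤ l`, given that `k` of the `Y_i` are one. -/
def failWeight (lam : ℝ) (l n k : ℕ) : ℝ :=
  (k : ℝ) / (n + 1) * binomTail lam (l + 1) (k - 1)

/-- The probability that `L ≤ l`, given that `k` of the `Y_i` are one. -/
def acceptWeight (lam : ℝ) (l n k : ℕ) : ℝ :=
  failWeight lam l n k + (1 - (k : ℝ) / (n + 1)) * binomTail lam (l + 1) k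

lemma prob_lastFails_inter_accept (lam : ℝ) {n : ℕ} (l : ℕ) {Q : (Fin (n + 1) → Bool) → ℝ}
    (hQ : Q ∈ exchangeable (n + 1)) :
    prob lam Q (lastFails n ∩ accept l n) = ∑ y, Q y * failWeight lam l n (ones y) := by
  classical
  have h := prob_inter_accept lam l Q {y | y (Fin.last n) = true}
  refine h.trans ?_
  simp only [failWeight]
  rw [← sum_last_eq hQ fun k => binomTail lam (l + 1) (k - 1)]
  refine Finset.sum_congr rfl fun y _ => ?_
  rw [ones_castSucc y]
  by_cases hy : y (Fin.last n) = true <;> simp [hy]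

lemma prob_accept (lam : ℝ) {n : ℕ} (l : ℕ) {Q : (Fin (n + 1) → Bool) → ℝ}
    (hQ : Q ∈ exchangeable (n + 1)) :
    prob lam Q (accept l n) = ∑ y, Q y * acceptWeight lam l n (ones y) := by
  classical
  have h := prob_inter_accept lam l Q univ
  simp only [mem_univ, ofPred_true, univ_inter, indicator_univ] at h
  have h1 := sum_last_eq hQ fun k => binomTail lam (l + 1) (k - 1)
  have h2 := sum_last_eq hQ fun k => binomTail lam (l + 1) k
  -- The first `n` coordinates contain `ones y - 1` or `ones y` ones, according to the last value.
  -- The truncated subtraction at `0` never matters, since `y (Fin.last n) = true` forces `ones y ≥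
  -- 1`.
  have h3 : (∑ y, Q y * binomTail lam (l + 1) (ones fun i : Fin n => y i.castSucc)) =
      (∑ y, if y (Fin.last n) = true then Q y * binomTail lam (l + 1) (ones y - 1) else 0) +
        (∑ y, Q y * binomTail lam (l + 1) (ones y)) -
        ∑ y, if y (Fin.last n) = true then Q y * binomTail lam (l + 1) (ones y) else 0 := by
    rw [← Finset.sum_add_distrib, ← Finset.sum_sub_distrib]
    refine Finset.sum_congr rfl fun y _ => ?_
    rw [ones_castSucc y]
    by_cases hy : y (Fin.last n) = true <;> simp [hy]
  rw [h, h3, h1, h2, ← Finset.sum_add_distrib, ← Finset.sum_sub_distrib]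
  refine Finset.sum_congr rfl fun y _ => ?_
  rw [acceptWeight, failWeight]
  ring

/-- Probability mass functions on `{0, …, n + 1}`. -/
def mixtures (n : ℕ) : Set (ℕ → ℝ) :=
  {w | (∀ k, 0 ≤ w k) ∧ (∀ k, n + 2 ≤ k → w k = 0) ∧ ∑ k ∈ Finset.range (n + 2), w k = 1}

/-- The mean of `f` under a mass function on `{0, …, n + 1}`. -/
def mean (n : ℕ) (w f : ℕ → ℝ) : ℝ := ∑ k ∈ Finset.range (n + 2), w k * f k

lemma exists_mixture_of_exchangeable {n : ℕ} {Q : (Fin (n + 1) → Bool) → ℝ}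
    (hQ : Q ∈ exchangeable (n + 1)) :
    ∃ w ∈ mixtures n, ∀ f : ℕ → ℝ, ∑ y, Q y * f (ones y) = mean n w f := by
  classical
  have hf : ∀ f : ℕ → ℝ, ∑ y, Q y * f (ones y) =
      mean n (fun k => ∑ y with ones y = k, Q y) f := by
    intro f
    rw [mean, ← Finset.sum_fiberwise_of_maps_to (s := Finset.univ) (t := Finset.range (n + 2))
      (g := ones) (fun y _ => Finset.mem_range.2 (Nat.lt_succ_of_le (ones_le y)))]
    refine Finset.sum_congr rfl fun k _ => ?_
    rw [Finset.sum_mul]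
    refine Finset.sum_congr rfl fun y hy => ?_
    rw [(Finset.mem_filter.1 hy).2]
  refine ⟨_, ⟨fun k => Finset.sum_nonneg fun y _ => hQ.1.1 y, fun k hk => ?_, ?_⟩, hf⟩
  · refine Finset.sum_eq_zero fun y hy => ?_
    have := (Finset.mem_filter.1 hy).2
    have := ones_le y
    omega
  · have := hf fun _ => 1
    simp only [mul_one, mean] at this
    rw [← this]
    exact hQ.1.2

lemma exists_exchangeable_of_mixture {n : ℕ} {w : ℕ → ℝ} (hw : w ∈ mixtures n) :
    ∃ Q ∈ exchangeable (n + 1), ∀ f : ℕ → ℝ, ∑ y, Q y * f (ones y) = mean n w f := by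
  classical
  -- The mass `w k` is spread uniformly over the `c k` vectors with `k` ones.
  let c : ℕ → ℝ := fun k => ((Finset.univ.filter fun y : Fin (n + 1) → Bool => ones y = k).card : ℝ)
  have hf : ∀ f : ℕ → ℝ, ∑ y : Fin (n + 1) → Bool, w (ones y) / c (ones y) * f (ones y) =
      mean n w f := by
    intro f
    rw [mean, ← Finset.sum_fiberwise_of_maps_to (s := Finset.univ) (t := Finset.range (n + 2))
      (g := ones) (fun y _ => Finset.mem_range.2 (Nat.lt_succ_of_le (ones_le y)))]
    refine Finset.sum_congr rfl fun k hk => ?_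
    have hc : c k ≠ 0 := by
      obtain ⟨y, hy⟩ := exists_ones_eq (n := n + 1) (k := k) (by
        have := Finset.mem_range.1 hk; omega)
      exact Nat.cast_ne_zero.2 (Finset.card_ne_zero.2 ⟨y, by simp [hy]⟩)
    rw [Finset.sum_congr rfl (g := fun _ => w k / c k * f k) fun y hy => by
      rw [(Finset.mem_filter.1 hy).2], Finset.sum_const, nsmul_eq_mul]
    change c k * _ = _
    field_simp
  refine ⟨fun y => w (ones y) / c (ones y), ⟨⟨fun y => ?_, ?_⟩, fun σ y => ?_⟩, hf⟩
  · exact div_nonneg (hw.1 _) (Nat.cast_nonneg _)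
  · have := hf fun _ => 1
    simp only [mul_one, mean] at this
    rw [this, hw.2.2]
  · simp only [ones_comp_perm]

lemma upperConfidenceLimit_eq (lam : ℝ) (l n : ℕ) (δ : ℝ) :
    upperConfidenceLimit lam l n δ =
      sSup {x | ∃ w ∈ mixtures n, δ ≤ mean n w (acceptWeight lam l n) ∧
        x = mean n w (failWeight lam l n) / mean n w (acceptWeight lam l n)} := by
  rw [upperConfidenceLimit]
  congr 1
  ext x
  constructor
  · rintro ⟨Q, hQ, h, rfl⟩
    obtain ⟨w, hw, hf⟩ := exists_mixture_of_exchangeable hQ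
    refine ⟨w, hw, ?_, ?_⟩
    · rwa [prob_accept lam l hQ, hf] at h
    · rw [condProb, prob_lastFails_inter_accept lam l hQ, prob_accept lam l hQ, hf, hf]
  · rintro ⟨w, hw, h, rfl⟩
    obtain ⟨Q, hQ, hf⟩ := exists_exchangeable_of_mixture hw
    refine ⟨Q, hQ, ?_, ?_⟩
    · rwa [prob_accept lam l hQ, hf]
    · rw [condProb, prob_lastFails_inter_accept lam l hQ, prob_accept lam l hQ, hf, hf]

/-! ### Estimates for the binomial tail -/

lemma binomTail_succ_succ (lam : ℝ) (m k : ℕ) : binomTail lam (m + 1) (k + 1) =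
    lam * binomTail lam (m + 1) k + (1 - lam) * binomTail lam m k := rfl

section

variable {lam : ℝ}

lemma binomTail_nonneg (h0 : 0 < lam) (h1 : lam < 1) (m k : ℕ) : 0 ≤ binomTail lam m k := by
  induction k generalizing m with
  | zero => cases m <;> simp [binomTail]
  | succ k ih =>
    cases m with
    | zero => simp [binomTail]
    | succ m =>
      rw [binomTail_succ_succ]
      exact add_nonneg (mul_nonneg h0.le (ih _)) (mul_nonneg (by linarith) (ih _))

lemma binomTail_le_succ_left (h0 : 0 < lam) (h1 : lam < 1) (m k : ℕ) :
    binomTail lam m k ≤ binomTail lam (m + 1) k := by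
  induction k generalizing m with
  | zero => cases m <;> simp [binomTail]
  | succ k ih =>
    cases m with
    | zero => exact binomTail_nonneg h0 h1 _ _
    | succ m =>
      rw [binomTail_succ_succ, binomTail_succ_succ]
      exact add_le_add (mul_le_mul_of_nonneg_left (ih _) h0.le)
        (mul_le_mul_of_nonneg_left (ih _) (by linarith))

lemma binomTail_succ_right_le (h0 : 0 < lam) (h1 : lam < 1) (m k : ℕ) :
    binomTail lam m (k + 1) ≤ binomTail lam m k := by
  cases m with
  | zero => simp [binomTail]
  | succ m =>
    rw [binomTail_succ_succ]
    nlinarith [binomTail_le_succ_left h0 h1 m k]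

lemma binomTail_le_pred (h0 : 0 < lam) (h1 : lam < 1) (m k : ℕ) :
    binomTail lam m k ≤ binomTail lam m (k - 1) := by
  cases k with
  | zero => exact le_rfl
  | succ k => exact binomTail_succ_right_le h0 h1 m k

lemma mul_binomTail_pred_le (h0 : 0 < lam) (h1 : lam < 1) (m k : ℕ) :
    lam * binomTail lam m (k - 1) ≤ binomTail lam m k := by
  cases m with
  | zero => simp [binomTail]
  | succ m =>
    cases k with
    | zero => simpa [binomTail] using h1.le
    | succ k =>
      rw [binomTail_succ_succ, Nat.add_sub_cancel]
      nlinarith [binomTail_nonneg h0 h1 m k]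

lemma pow_le_binomTail (h0 : 0 < lam) (h1 : lam < 1) (m k : ℕ) :
    lam ^ k ≤ binomTail lam (m + 1) k := by
  induction k with
  | zero => simp [binomTail]
  | succ k ih =>
    have := mul_binomTail_pred_le h0 h1 (m + 1) (k + 1)
    rw [Nat.add_sub_cancel] at this
    rw [pow_succ]
    nlinarith

lemma binomTail_succ_pos (h0 : 0 < lam) (h1 : lam < 1) (m k : ℕ) :
    0 < binomTail lam (m + 1) k :=
  (pow_pos h0 k).trans_le (pow_le_binomTail h0 h1 m k)

/-- For `X` binomial with `k` trials, `k (1 - lam)` times the tail with `k - 1` trials is the mean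
of `X` on `X ≤ m`, hence at most `m * P(X ≤ m)`. The formal proof is by induction: the extra summand
from `k + 1` is paid for by the gap between the coefficients `m` and `m + 1`. -/
lemma mul_binomTail_le (h0 : 0 < lam) (h1 : lam < 1) (m k : ℕ) :
    k * ((1 - lam) * binomTail lam m k) ≤ m * binomTail lam (m + 1) k := by
  induction k generalizing m with
  | zero => simpa using mul_nonneg m.cast_nonneg (binomTail_nonneg h0 h1 (m + 1) 0)
  | succ k ih =>
    cases m with
    | zero => simp [binomTail]
    | succ m =>
      have e1 := ih (m + 1)
      have e2 := ih m
      have e3 := binomTail_succ_right_le h0 h1 (m + 1) k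
      rw [binomTail_succ_succ lam (m + 1) k]
      rw [binomTail_succ_succ] at e3 ⊢
      push_cast at *
      have e4 := mul_le_mul_of_nonneg_left e1 h0.le
      have e5 := mul_le_mul_of_nonneg_left e2 (sub_nonneg.2 h1.le)
      have e6 := mul_le_mul_of_nonneg_left e3 (sub_nonneg.2 h1.le)
      linarith

/-- The ratio of consecutive values is at most `lam + m / k`. -/
lemma binomTail_succ_le_mul (h0 : 0 < lam) (h1 : lam < 1) (m : ℕ) {k : ℕ} (hk : 0 < k) :
    binomTail lam (m + 1) (k + 1) ≤ (lam + m / k) * binomTail lam (m + 1) k := by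
  have hk' : (0 : ℝ) < k := Nat.cast_pos.2 hk
  have := mul_binomTail_le h0 h1 m k
  rw [binomTail_succ_succ, add_mul, div_mul_eq_mul_div]
  gcongr
  rw [le_div_iff₀ hk']
  linarith

/-- Any base above `lam` absorbs the polynomial factor in front of `lam ^ k`. -/
lemma exists_binomTail_le (h0 : 0 < lam) (h1 : lam < 1) {θ : ℝ} (hθ : lam < θ) (m : ℕ) :
    ∃ C, 0 < C ∧ ∀ k, binomTail lam m k ≤ C * θ ^ k := by
  induction m with
  | zero =>
    exact ⟨1, one_pos, fun k => by
      have : 0 < θ := h0.trans hθ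
      simpa [binomTail] using (pow_pos this k).le⟩
  | succ m ih =>
    obtain ⟨C, hC, h⟩ := ih
    have hθ0 : 0 < θ := h0.trans hθ
    have hd : 0 < θ - lam := sub_pos.2 hθ
    refine ⟨max 1 ((1 - lam) * C / (θ - lam)), lt_max_of_lt_left one_pos, fun k => ?_⟩
    induction k with
    | zero => simp [binomTail]
    | succ k ihk =>
      have hp := pow_pos hθ0 k
      have e1 : (1 - lam) * C ≤ max 1 ((1 - lam) * C / (θ - lam)) * (θ - lam) := by
        rw [← div_le_iff₀ hd]
        exact le_max_right _ _
      set D := max 1 ((1 - lam) * C / (θ - lam))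
      rw [binomTail_succ_succ]
      calc lam * binomTail lam (m + 1) k + (1 - lam) * binomTail lam m k
          ≤ lam * (D * θ ^ k) + (1 - lam) * (C * θ ^ k) := by
            have := h k
            have : 0 ≤ 1 - lam := by linarith
            gcongr
        _ = (lam * D + (1 - lam) * C) * θ ^ k := by ring
        _ ≤ (D * θ) * θ ^ k := by gcongr; linarith
        _ = D * θ ^ (k + 1) := by ring

/-- `mul_binomTail_le` trades the factor `k` for one more allowed failure, which costs only a
constant. -/
lemma exists_mul_binomTail_le (h0 : 0 < lam) (h1 : lam < 1) {θ : ℝ} (hθ : lam < θ) (m : ℕ) :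
    ∃ C, 0 < C ∧ ∀ k : ℕ, (k + 1) * binomTail lam m (k - 1) ≤ C * θ ^ k := by
  obtain ⟨C, hC, h⟩ := exists_binomTail_le h0 h1 hθ m
  obtain ⟨D, hD, h'⟩ := exists_binomTail_le h0 h1 hθ (m + 1)
  have hθ0 : 0 < θ := h0.trans hθ
  have hν : 0 < 1 - lam := sub_pos.2 h1
  refine ⟨(C + m / (1 - lam) * D) / lam, by positivity, fun k => ?_⟩
  have e1 : lam * binomTail lam m (k - 1) ≤ binomTail lam m k := mul_binomTail_pred_le h0 h1 m k
  have e2 : (k : ℝ) * binomTail lam m k ≤ m / (1 - lam) * binomTail lam (m + 1) k := by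
    rw [div_mul_eq_mul_div, le_div_iff₀ hν]
    linarith [mul_binomTail_le h0 h1 m k]
  have e3 : (m : ℝ) / (1 - lam) * binomTail lam (m + 1) k ≤ m / (1 - lam) * (D * θ ^ k) :=
    mul_le_mul_of_nonneg_left (h' k) (by positivity)
  rw [div_mul_eq_mul_div, le_div_iff₀ h0]
  calc (k + 1) * binomTail lam m (k - 1) * lam
      = (k + 1) * (lam * binomTail lam m (k - 1)) := by ring
    _ ≤ (k + 1) * binomTail lam m k := by gcongr
    _ ≤ (C + m / (1 - lam) * D) * θ ^ k := by linarith [h k]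

lemma exists_mul_binomTail_le_const (h0 : 0 < lam) (h1 : lam < 1) (m : ℕ) :
    ∃ C, 0 < C ∧ ∀ k : ℕ, k * binomTail lam m (k - 1) ≤ C := by
  obtain ⟨C, hC, h⟩ := exists_mul_binomTail_le h0 h1 h1 m
  refine ⟨C, hC, fun k => ?_⟩
  have := h k
  rw [one_pow, mul_one] at this
  linarith [binomTail_nonneg h0 h1 m (k - 1)]

/-! ### Primal and dual bounds for the confidence limit -/

variable {l n k : ℕ}

lemma div_le_one_of_le_succ (hk : k ≤ n + 1) : (k : ℝ) / (n + 1) ≤ 1 := by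
  rw [div_le_one (by positivity)]
  exact_mod_cast hk

lemma failWeight_le_acceptWeight (h0 : 0 < lam) (h1 : lam < 1) (hk : k ≤ n + 1) :
    failWeight lam l n k ≤ acceptWeight lam l n k := by
  have := mul_nonneg (sub_nonneg.2 (div_le_one_of_le_succ hk))
    (binomTail_nonneg h0 h1 (l + 1) k)
  rw [acceptWeight]
  linarith

lemma acceptWeight_le (h0 : 0 < lam) (h1 : lam < 1) (hk : k ≤ n + 1) :
    acceptWeight lam l n k ≤ binomTail lam (l + 1) (k - 1) := by
  have := mul_le_mul_of_nonneg_left (binomTail_le_pred h0 h1 (l + 1) k)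
    (sub_nonneg.2 (div_le_one_of_le_succ hk))
  rw [acceptWeight, failWeight]
  linarith

lemma binomTail_le_acceptWeight (h0 : 0 < lam) (h1 : lam < 1) :
    binomTail lam (l + 1) k ≤ acceptWeight lam l n k := by
  have := mul_le_mul_of_nonneg_left (binomTail_le_pred h0 h1 (l + 1) k)
    (show (0 : ℝ) ≤ (k : ℝ) / (n + 1) by positivity)
  rw [acceptWeight, failWeight]
  linarith

lemma acceptWeight_zero : acceptWeight lam l n 0 = 1 := by
  simp [acceptWeight, failWeight, binomTail]

lemma failWeight_zero : failWeight lam l n 0 = 0 := by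
  simp [failWeight]

lemma mean_le_mean {w f g : ℕ → ℝ} (hw : w ∈ mixtures n) (h : ∀ k ≤ n + 1, f k ≤ g k) :
    mean n w f ≤ mean n w g :=
  Finset.sum_le_sum fun k hk => mul_le_mul_of_nonneg_left
    (h k (by have := Finset.mem_range.1 hk; omega)) (hw.1 k)

lemma mean_const {w : ℕ → ℝ} (hw : w ∈ mixtures n) (c : ℝ) : mean n w (fun _ => c) = c := by
  rw [mean, ← Finset.sum_mul, hw.2.2, one_mul]

lemma mean_sub (w f g : ℕ → ℝ) : mean n w (fun k => f k - g k) = mean n w f - mean n w g := by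
  simp [mean, mul_sub]

lemma mean_const_mul (w f : ℕ → ℝ) (c : ℝ) : mean n w (fun k => c * f k) = c * mean n w f := by
  simp only [mean, Finset.mul_sum]
  exact Finset.sum_congr rfl fun _ _ => by ring

lemma single_mem_mixtures (hk : k ≤ n + 1) : Pi.single k 1 ∈ mixtures n := by
  refine ⟨fun j => ?_, fun j hj => ?_, ?_⟩
  · by_cases h : j = k <;> simp [h]
  · rw [Pi.single_apply, if_neg (by omega)]
  · simp [Pi.single_apply, Nat.lt_succ_of_le hk]

lemma mean_single (hk : k ≤ n + 1) (f : ℕ → ℝ) : mean n (Pi.single k 1) f = f k := by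
  simp [mean, Pi.single_apply, Nat.lt_succ_of_le hk]

lemma mean_combine (w v f : ℕ → ℝ) (s : ℝ) :
    mean n ((1 - s) • w + s • v) f = (1 - s) * mean n w f + s * mean n v f := by
  simp only [mean, Finset.mul_sum, ← Finset.sum_add_distrib]
  refine Finset.sum_congr rfl fun _ _ => ?_
  simp only [Pi.add_apply, Pi.smul_apply, smul_eq_mul]
  ring

lemma combine_mem_mixtures {w v : ℕ → ℝ} (hw : w ∈ mixtures n) (hv : v ∈ mixtures n) {s : ℝ}
    (hs0 : 0 ≤ s) (hs1 : s ≤ 1) : (1 - s) • w + s • v ∈ mixtures n := by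
  refine ⟨fun k => ?_, fun k hk => ?_, ?_⟩
  · exact add_nonneg (mul_nonneg (sub_nonneg.2 hs1) (hw.1 k)) (mul_nonneg hs0 (hv.1 k))
  · simp [hw.2.1 k hk, hv.2.1 k hk]
  · simpa [mean, hw.2.2, hv.2.2] using mean_combine (n := n) w v (fun _ => 1) s

lemma upperConfidenceLimit_le {δ ε : ℝ} (hδ0 : 0 < δ) (hδ1 : δ ≤ 1)
    (h : ∀ w ∈ mixtures n, δ ≤ mean n w (acceptWeight lam l n) →
      mean n w (failWeight lam l n) ≤ ε * mean n w (acceptWeight lam l n)) :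
    upperConfidenceLimit lam l n δ ≤ ε := by
  rw [upperConfidenceLimit_eq]
  refine csSup_le ⟨_, Pi.single 0 1, single_mem_mixtures (Nat.zero_le _), ?_, rfl⟩ ?_
  · rwa [mean_single (Nat.zero_le _), acceptWeight_zero]
  · rintro x ⟨w, hw, hH, rfl⟩
    rw [div_le_iff₀ (hδ0.trans_le hH)]
    exact h w hw hH

lemma div_le_upperConfidenceLimit (h0 : 0 < lam) (h1 : lam < 1) {δ : ℝ} (hδ0 : 0 < δ)
    {w : ℕ → ℝ} (hw : w ∈ mixtures n) (hH : δ ≤ mean n w (acceptWeight lam l n)) :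
    mean n w (failWeight lam l n) / mean n w (acceptWeight lam l n) ≤
      upperConfidenceLimit lam l n δ := by
  rw [upperConfidenceLimit_eq]
  refine le_csSup ⟨1, ?_⟩ ⟨w, hw, hH, rfl⟩
  rintro x ⟨v, hv, hHv, rfl⟩
  rw [div_le_one (hδ0.trans_le hHv)]
  exact mean_le_mean hv fun k hk => failWeight_le_acceptWeight h0 h1 hk

/-- A lower bound from mass concentrated on one value. -/
lemma div_weight_le_upperConfidenceLimit (h0 : 0 < lam) (h1 : lam < 1) {δ : ℝ} (hδ0 : 0 < δ)
    (hk : k ≤ n + 1) (hδ : δ ≤ lam ^ k) :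
    failWeight lam l n k / acceptWeight lam l n k ≤ upperConfidenceLimit lam l n δ := by
  have h := div_le_upperConfidenceLimit (l := l) h0 h1 hδ0 (single_mem_mixtures hk)
  rw [mean_single hk, mean_single hk] at h
  exact h (hδ.trans ((pow_le_binomTail h0 h1 l k).trans (binomTail_le_acceptWeight h0 h1)))

/-- A linear programming certificate for an upper bound. -/
lemma upperConfidenceLimit_le_of_dual {δ ε μ : ℝ} (hδ0 : 0 < δ) (hδ1 : δ ≤ 1) (hμ : 0 ≤ μ)
    (h : ∀ k ≤ n + 1, failWeight lam l n k - (ε - μ) * acceptWeight lam l n k ≤ μ * δ) :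
    upperConfidenceLimit lam l n δ ≤ ε := by
  refine upperConfidenceLimit_le hδ0 hδ1 fun w hw hH => ?_
  have := mean_le_mean hw (g := fun _ => μ * δ) h
  rw [mean_const hw, mean_sub, mean_const_mul] at this
  nlinarith

end

/-! ### The limit `ε → 0` at fixed `δ` -/

/-- A bounded, almost nondecreasing sequence converges; the limit is the supremum of `c n * a n`
over large `n`. -/
lemma exists_tendsto_of_mul_le {a c : ℕ → ℝ} {C : ℝ} (h0 : ∀ n, 0 ≤ a n) (hC : ∀ n, a n ≤ C)
    (hc : Tendsto c atTop (𝓝 1)) (h : ∀ᶠ n in atTop, ∀ m ≥ n, c n * a n ≤ a m) :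
    ∃ M, Tendsto a atTop (𝓝 M) := by
  obtain ⟨n₀, hn₀⟩ := eventually_atTop.1 h
  let S : Set ℝ := (fun n => c n * a n) '' Ici n₀
  have hne : S.Nonempty := nonempty_Ici.image _
  have hbdd : BddAbove S := by
    refine ⟨C, ?_⟩
    rintro _ ⟨n, hn, rfl⟩
    exact (hn₀ n hn n le_rfl).trans (hC n)
  have hdiff : Tendsto (fun n => (1 - c n) * a n) atTop (𝓝 0) := by
    have h1 : Tendsto (fun n => 1 - c n) atTop (𝓝 0) := by
      simpa using (tendsto_const_nhds (x := (1 : ℝ))).sub hc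
    refine Tendsto.zero_mul_isBoundedUnder_le h1 ?_
    refine ⟨C, eventually_map.2 (Eventually.of_forall fun n => ?_)⟩
    simpa [abs_of_nonneg (h0 n)] using hC n
  refine ⟨sSup S, Metric.tendsto_atTop.2 fun ε hε => ?_⟩
  obtain ⟨_, ⟨n₁, hn₁, rfl⟩, hlt⟩ := exists_lt_of_lt_csSup hne (sub_lt_self (sSup S) hε)
  obtain ⟨n₂, hn₂⟩ := eventually_atTop.1 (hdiff.eventually (gt_mem_nhds hε))
  refine ⟨max n₀ (max n₁ n₂), fun n hn => ?_⟩
  have hn0 : n₀ ≤ n := (le_max_left _ _).trans hn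
  have hn1 : n₁ ≤ n := ((le_max_left _ _).trans (le_max_right _ _)).trans hn
  have hn2 : n₂ ≤ n := ((le_max_right _ _).trans (le_max_right _ _)).trans hn
  have e1 := hn₀ n₁ hn₁ n hn1
  have e2 := hn₂ n hn2
  have e3 : c n * a n ≤ sSup S := le_csSup hbdd ⟨n, hn0, rfl⟩
  rw [Real.dist_eq, abs_lt]
  constructor <;> linarith

/-- If `n * φ n` converges to a positive limit, then the first `n` with `φ n ≤ ε` is
asymptotically equal to that limit divided by `ε`. -/
lemma tendsto_mul_sInf {φ : ℕ → ℝ} {M c : ℝ} (L : ℕ) (hc : 0 < c)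
    (hφc : ∀ n : ℕ, c ≤ (n + 1) * φ n)
    (hφ : Tendsto (fun n : ℕ => (n + 1) * φ n) atTop (𝓝 M)) :
    Tendsto (fun ε : ℝ => ε * (sInf {n : ℕ | L ≤ n ∧ φ n ≤ ε} : ℕ)) (𝓝[>] 0) (𝓝 M) := by
  set N : ℝ → ℕ := fun ε => sInf {n : ℕ | L ≤ n ∧ φ n ≤ ε} with hN
  have hφ0 : Tendsto φ atTop (𝓝 0) := by
    have := hφ.mul tendsto_one_div_add_atTop_nhds_zero_nat
    rw [mul_zero] at this
    refine this.congr fun n => ?_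
    have : (n : ℝ) + 1 ≠ 0 := by positivity
    field_simp
  have hmem : ∀ ε : ℝ, 0 < ε → L ≤ N ε ∧ φ (N ε) ≤ ε := by
    intro ε hε
    have hne : {n : ℕ | L ≤ n ∧ φ n ≤ ε}.Nonempty := by
      obtain ⟨n, hn⟩ := ((eventually_ge_atTop L).and (hφ0.eventually (gt_mem_nhds hε))).exists
      exact ⟨n, hn.1, hn.2.le⟩
    exact Nat.sInf_mem hne
  have hε0 : ∀ᶠ ε : ℝ in 𝓝[>] 0, 0 < ε := eventually_mem_nhdsWithin
  -- The lower bound on `(n + 1) * φ n` forces `N ε + 1 ≥ c / ε`.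
  have hNtop : Tendsto N (𝓝[>] 0) atTop := by
    have h1 : Tendsto (fun ε : ℝ => c * ε⁻¹ + -1) (𝓝[>] 0) atTop :=
      tendsto_atTop_add_const_right _ _ (tendsto_inv_nhdsGT_zero.const_mul_atTop hc)
    refine tendsto_natCast_atTop_iff.1 (tendsto_atTop_mono' _ ?_ h1)
    filter_upwards [hε0] with ε hε
    have h2 := hφc (N ε)
    have h3 : ((N ε : ℝ) + 1) * φ (N ε) ≤ (N ε + 1) * ε := by
      gcongr
      exact (hmem ε hε).2
    have : c * ε⁻¹ ≤ N ε + 1 := by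
      rw [← div_eq_mul_inv, div_le_iff₀ hε]
      exact h2.trans h3
    linarith
  have hlow : Tendsto (fun ε : ℝ => ((N ε : ℝ) + 1) * φ (N ε) - ε) (𝓝[>] 0) (𝓝 M) := by
    have h1 := (hφ.comp hNtop).sub (tendsto_id.mono_left (nhdsWithin_le_nhds (s := Ioi (0 : ℝ))))
    rw [sub_zero] at h1
    exact h1
  -- By minimality `φ (N ε - 1) > ε`, so this sequence, shifted by one, bounds `ε * N ε` from above.
  have hup : Tendsto (fun ε : ℝ => (((N ε - 1 : ℕ) : ℝ) + 1) * φ (N ε - 1)) (𝓝[>] 0) (𝓝 M) :=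
    hφ.comp ((tendsto_sub_atTop_nat 1).comp hNtop)
  refine tendsto_of_tendsto_of_tendsto_of_le_of_le' hlow hup ?_ ?_
  · filter_upwards [hε0] with ε hε
    have h3 : ((N ε : ℝ) + 1) * φ (N ε) ≤ (N ε + 1) * ε := by
      gcongr
      exact (hmem ε hε).2
    linarith
  · filter_upwards [hε0, hNtop.eventually_ge_atTop (L + 1)] with ε hε hNε
    have h1 : N ε - 1 ∉ {n : ℕ | L ≤ n ∧ φ n ≤ ε} := Nat.notMem_of_lt_sInf (by
      change N ε - 1 < N ε
      omega)
    have h2 : ε < φ (N ε - 1) := by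
      by_contra hcon
      exact h1 ⟨by omega, not_lt.1 hcon⟩
    have h3 : (((N ε - 1 : ℕ) : ℝ) + 1) = N ε := by
      rw [Nat.cast_sub (by omega)]
      simp
    rw [h3, mul_comm]
    gcongr

section

variable {lam : ℝ} {l n m : ℕ}

lemma mixtures_mono (hnm : n ≤ m) {w : ℕ → ℝ} (hw : w ∈ mixtures n) :
    w ∈ mixtures m ∧ ∀ f, mean m w f = mean n w f := by
  have h : ∀ f, mean m w f = mean n w f := fun f => by
    refine (Finset.sum_subset (Finset.range_mono (by omega)) fun k _ hk => ?_).symm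
    rw [hw.2.1 k (by simpa using hk), zero_mul]
  refine ⟨⟨hw.1, fun k hk => hw.2.1 k (by omega), ?_⟩, h⟩
  simpa [mean, hw.2.2] using h fun _ => 1

lemma acceptWeight_eq (k : ℕ) : acceptWeight lam l n k = binomTail lam (l + 1) k +
    (k * binomTail lam (l + 1) (k - 1) - k * binomTail lam (l + 1) k) / (n + 1) := by
  rw [acceptWeight, failWeight]
  ring

lemma acceptWeight_le_acceptWeight (h0 : 0 < lam) (h1 : lam < 1) (hnm : n ≤ m) (k : ℕ) :
    acceptWeight lam l m k ≤ acceptWeight lam l n k := by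
  have := mul_le_mul_of_nonneg_left (binomTail_le_pred h0 h1 (l + 1) k) k.cast_nonneg
  rw [acceptWeight_eq, acceptWeight_eq]
  gcongr

lemma acceptWeight_sub_le (h0 : 0 < lam) (h1 : lam < 1) {C : ℝ}
    (hC : ∀ k : ℕ, k * binomTail lam (l + 1) (k - 1) ≤ C) (k : ℕ) :
    acceptWeight lam l n k - C / (n + 1) ≤ acceptWeight lam l m k := by
  have e1 := binomTail_le_acceptWeight h0 h1 (l := l) (n := m) (k := k)
  have e2 := mul_nonneg k.cast_nonneg (binomTail_nonneg h0 h1 (l + 1) k)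
  have e3 : (k * binomTail lam (l + 1) (k - 1) - k * binomTail lam (l + 1) k) / (n + 1) ≤
      C / ((n : ℝ) + 1) := by
    gcongr
    linarith [hC k]
  rw [acceptWeight_eq]
  linarith

lemma mul_mean_failWeight (w : ℕ → ℝ) : ((n : ℝ) + 1) * mean n w (failWeight lam l n) =
    mean n w fun k => k * binomTail lam (l + 1) (k - 1) := by
  rw [← mean_const_mul]
  congr 1
  ext k
  have : (n : ℝ) + 1 ≠ 0 := by positivity
  rw [failWeight]
  field_simp

/-- A mixture feasible for `n` is reused for `m`. Its acceptance probability drops by at most `C /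
(n + 1) = s (1 - δ)`, and moving a share `s` of the mass to `k = 0` restores feasibility. The
numerator loses a factor `1 - s`, and the denominator grows by a factor of at most `1 + s / δ`. -/
lemma upperConfidenceLimit_transfer (h0 : 0 < lam) (h1 : lam < 1) {δ C s : ℝ} (hδ0 : 0 < δ)
    (hδ1 : δ < 1) (hC0 : 0 < C) (hC : ∀ k : ℕ, k * binomTail lam (l + 1) (k - 1) ≤ C)
    (hs : s = C / (n + 1) / (1 - δ)) (hs1 : s < 1) (hnm : n ≤ m) :
    (1 - s) / (1 + s / δ) * ((n + 1) * upperConfidenceLimit lam l n δ) ≤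
      (m + 1) * upperConfidenceLimit lam l m δ := by
  have hδ' : 0 < 1 - δ := sub_pos.2 hδ1
  have hs0 : 0 < s := by rw [hs]; positivity
  have hs' : 0 < 1 - s := sub_pos.2 hs1
  have hη : C / (n + 1) = s * (1 - δ) := by rw [hs]; field_simp
  have hcoef : 0 < (1 - s) / (1 + s / δ) * (n + 1) := by positivity
  rw [← mul_assoc, ← le_div_iff₀' hcoef]
  refine upperConfidenceLimit_le hδ0 hδ1.le fun w hw hH => ?_
  obtain ⟨hwm, hmean⟩ := mixtures_mono hnm hw
  set H := mean n w (acceptWeight lam l n) with hHdef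
  set Γ := mean n w fun k => k * binomTail lam (l + 1) (k - 1) with hΓ
  have hG : mean n w (failWeight lam l n) = Γ / (n + 1) := by
    rw [eq_div_iff (by positivity), mul_comm, mul_mean_failWeight]
  have hGm : mean m w (failWeight lam l m) = Γ / (m + 1) := by
    rw [eq_div_iff (by positivity), mul_comm, mul_mean_failWeight, hmean]
  have hΓ0 : 0 ≤ Γ := Finset.sum_nonneg fun k _ => mul_nonneg (hw.1 k)
    (mul_nonneg k.cast_nonneg (binomTail_nonneg h0 h1 _ _))
  set H' := mean m w (acceptWeight lam l m) with hH'def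
  have hH'1 : H' ≤ H := by
    rw [hH'def, hmean]
    exact mean_le_mean hw fun k _ => acceptWeight_le_acceptWeight h0 h1 hnm k
  have hH'2 : H - s * (1 - δ) ≤ H' := by
    rw [hH'def, hmean, ← mean_const hw (s * (1 - δ)), hHdef, ← mean_sub]
    refine mean_le_mean hw fun k _ => ?_
    rw [← hη]
    exact acceptWeight_sub_le h0 h1 hC k
  have hz : (Pi.single 0 1 : ℕ → ℝ) ∈ mixtures m := single_mem_mixtures (Nat.zero_le _)
  have key := div_le_upperConfidenceLimit (l := l) h0 h1 hδ0
    (combine_mem_mixtures hwm hz hs0.le hs1.le)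
  rw [mean_combine, mean_combine, mean_single (Nat.zero_le _), mean_single (Nat.zero_le _),
    acceptWeight_zero, failWeight_zero, hGm, ← hH'def] at key
  -- With `H' ≥ δ - s (1 - δ)` the right side is at least `δ + s² (1 - δ)`.
  have hfeas : δ ≤ (1 - s) * H' + s * 1 := by
    nlinarith [mul_pos hs0 hδ', mul_pos (mul_pos hs0 hs0) hδ']
  have key := key hfeas
  set φ := upperConfidenceLimit lam l m δ
  rw [div_le_iff₀ (hδ0.trans_le hfeas)] at key
  have hφ0 : 0 ≤ φ := by
    by_contra hcon
    have : (0 : ℝ) ≤ (1 - s) * (Γ / (m + 1)) + s * 0 := by positivity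
    nlinarith
  have hbound : (1 - s) * H' + s * 1 ≤ (1 + s / δ) * H := by
    have : s ≤ s / δ * H := by
      rw [div_mul_eq_mul_div, le_div_iff₀ hδ0]
      gcongr
    nlinarith
  have key2 : (1 - s) * (Γ / (m + 1)) ≤ φ * ((1 + s / δ) * H) := by
    linarith [mul_le_mul_of_nonneg_left hbound hφ0]
  have hA : 0 < 1 + s / δ := by positivity
  rw [hG, div_mul_eq_mul_div, le_div_iff₀ hcoef]
  calc Γ / (n + 1) * ((1 - s) / (1 + s / δ) * (n + 1))
      = (1 - s) * (Γ / (m + 1)) * ((m + 1) / (1 + s / δ)) := by field_simp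
    _ ≤ φ * ((1 + s / δ) * H) * ((m + 1) / (1 + s / δ)) := by gcongr
    _ = (m + 1) * φ * H := by field_simp

lemma mul_upperConfidenceLimit_le {δ C : ℝ} (hδ0 : 0 < δ)
    (hδ1 : δ < 1) (hC0 : 0 < C) (hC : ∀ k : ℕ, k * binomTail lam (l + 1) (k - 1) ≤ C) :
    (n + 1) * upperConfidenceLimit lam l n δ ≤ C / δ := by
  have hn : (0 : ℝ) < n + 1 := by positivity
  rw [← le_div_iff₀' hn]
  refine upperConfidenceLimit_le hδ0 hδ1.le fun w hw hH => ?_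
  have e1 : ((n : ℝ) + 1) * mean n w (failWeight lam l n) ≤ C := by
    rw [mul_mean_failWeight]
    exact (mean_le_mean hw fun k _ => hC k).trans_eq (mean_const hw C)
  rw [← mul_le_mul_iff_right₀ hn]
  refine e1.trans ?_
  calc C = C / δ * δ := by field_simp
    _ ≤ C / δ * mean n w (acceptWeight lam l n) := by gcongr
    _ = _ := by field_simp

/-- Witness: mass `δ` on `k = 0`, always accepted, and `1 - δ` on `k = 1`. -/
lemma le_mul_upperConfidenceLimit (h0 : 0 < lam) (h1 : lam < 1) {δ : ℝ} (hδ0 : 0 < δ)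
    (hδ1 : δ < 1) : 1 - δ ≤ (n + 1) * upperConfidenceLimit lam l n δ := by
  have hz : (Pi.single 0 1 : ℕ → ℝ) ∈ mixtures n := single_mem_mixtures (Nat.zero_le _)
  have ho : (Pi.single 1 1 : ℕ → ℝ) ∈ mixtures n := single_mem_mixtures (by omega)
  have key := div_le_upperConfidenceLimit (l := l) h0 h1 hδ0
    (combine_mem_mixtures hz ho (s := 1 - δ) (by linarith) (by linarith))
  have hh0 : 0 < acceptWeight lam l n 1 :=
    (binomTail_succ_pos h0 h1 l 1).trans_le (binomTail_le_acceptWeight h0 h1)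
  have hh1 : acceptWeight lam l n 1 ≤ 1 := acceptWeight_le h0 h1 (by omega)
  have hg : failWeight lam l n 1 = 1 / (n + 1) := by simp [failWeight, binomTail]
  rw [mean_combine, mean_combine, mean_single (Nat.zero_le _), mean_single (Nat.zero_le _),
    mean_single (by omega), mean_single (by omega), acceptWeight_zero, failWeight_zero, hg] at key
  have key := key (by nlinarith)
  have hD0 : 0 < (1 - (1 - δ)) * 1 + (1 - δ) * acceptWeight lam l n 1 := by nlinarith
  have hD1 : (1 - (1 - δ)) * 1 + (1 - δ) * acceptWeight lam l n 1 ≤ 1 := by nlinarith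
  have hn : (0 : ℝ) < n + 1 := by positivity
  have hX : 0 ≤ (1 - (1 - δ)) * 0 + (1 - δ) * (1 / ((n : ℝ) + 1)) := by
    have := mul_nonneg (sub_pos.2 hδ1).le (one_div_nonneg.2 hn.le)
    linarith
  have := (le_div_self hX hD0 hD1).trans key
  rw [← div_le_iff₀' hn]
  refine le_trans (le_of_eq ?_) this
  ring

lemma exists_tendsto_mul_upperConfidenceLimit (h0 : 0 < lam) (h1 : lam < 1) (l : ℕ) {δ : ℝ}
    (hδ0 : 0 < δ) (hδ1 : δ < 1) :
    ∃ M, Tendsto (fun n : ℕ => ((n : ℝ) + 1) * upperConfidenceLimit lam l n δ) atTop (𝓝 M) := by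
  obtain ⟨C, hC0, hC⟩ := exists_mul_binomTail_le_const h0 h1 (l + 1)
  let s : ℕ → ℝ := fun n => C / (n + 1) / (1 - δ)
  have hs : Tendsto s atTop (𝓝 0) := by
    have := (tendsto_one_div_add_atTop_nhds_zero_nat (𝕜 := ℝ)).const_mul (C / (1 - δ))
    rw [mul_zero] at this
    refine this.congr fun n => ?_
    simp only [s]
    ring
  refine exists_tendsto_of_mul_le (c := fun n => (1 - s n) / (1 + s n / δ)) (C := C / δ)
    (fun n => (sub_pos.2 hδ1).le.trans (le_mul_upperConfidenceLimit h0 h1 hδ0 hδ1))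
    (fun n => mul_upperConfidenceLimit_le hδ0 hδ1 hC0 hC) ?_ ?_
  · have h2 := ((tendsto_const_nhds (x := (1 : ℝ))).sub hs).div
      ((tendsto_const_nhds (x := (1 : ℝ))).add (hs.div_const δ)) (by simp)
    rw [sub_zero, zero_div, add_zero, div_one] at h2
    exact h2
  · filter_upwards [hs.eventually (gt_mem_nhds one_pos)] with n hn m hm
    exact upperConfidenceLimit_transfer h0 h1 hδ0 hδ1 hC0 hC rfl hn hm

lemma exists_tendsto_mul_minObservations (h0 : 0 < lam) (h1 : lam < 1) (l : ℕ) {δ : ℝ}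
    (hδ0 : 0 < δ) (hδ1 : δ < 1) :
    ∃ M, Tendsto (fun ε => ε * (minObservations lam l ε δ : ℝ)) (𝓝[>] 0) (𝓝 M) := by
  obtain ⟨M, hM⟩ := exists_tendsto_mul_upperConfidenceLimit h0 h1 l hδ0 hδ1
  exact ⟨M, tendsto_mul_sInf (l + 1) (sub_pos.2 hδ1)
    (fun n => le_mul_upperConfidenceLimit h0 h1 hδ0 hδ1) hM⟩

end

/-! ### Asymptotics for `δ → 0`, uniformly in `ε` -/

variable {lam : ℝ} {l n : ℕ}

/-- The slope `(1 - ε) / lam + ε`, so that a share `ε / slope` of failures has posterior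
failure probability `ε`. -/
def slope (lam ε : ℝ) : ℝ := (1 - ε) / lam + ε

lemma mul_slope (h0 : 0 < lam) (ε : ℝ) : lam * slope lam ε = 1 - ε + ε * lam := by
  rw [slope]
  field_simp

lemma one_le_slope (h0 : 0 < lam) (h1 : lam < 1) {ε : ℝ} (hε : ε < 1) : 1 ≤ slope lam ε := by
  have : 1 - ε ≤ (1 - ε) / lam := le_div_self (by linarith) h0 h1.le
  rw [slope]
  linarith

/-- The point mass at `j + 1` is feasible because `δ ≤ lam ^ (j + 1)`. The factor `lam / (lam + l /
j)` is the loss from bounding the tail ratio by `lam + l / j`. -/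
lemma le_of_upperConfidenceLimit_le (h0 : 0 < lam) (h1 : lam < 1) {δ ε : ℝ} (hδ0 : 0 < δ)
    (hε0 : 0 < ε) (hε1 : ε < 1) {j : ℕ} (hj : 0 < j) (hδ : δ ≤ lam ^ (j + 1))
    (h : upperConfidenceLimit lam l n δ ≤ ε) :
    (j + 1) * (lam / (lam + l / j)) ≤ (n + 1) * (ε / slope lam ε) := by
  have hT : 0 < slope lam ε := one_pos.trans_le (one_le_slope h0 h1 hε1)
  have hn : (0 : ℝ) < n + 1 := by positivity
  rcases le_or_gt (j + 1) (n + 1) with hjn | hjn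
  · have key := (div_weight_le_upperConfidenceLimit h0 h1 hδ0 hjn hδ).trans h
    have hB : 0 < binomTail lam (l + 1) j := binomTail_succ_pos h0 h1 l j
    have hacc : 0 < acceptWeight lam l n (j + 1) :=
      (binomTail_succ_pos h0 h1 l (j + 1)).trans_le (binomTail_le_acceptWeight h0 h1)
    rw [div_le_iff₀ hacc, acceptWeight, failWeight, Nat.add_sub_cancel] at key
    have hr := binomTail_succ_le_mul h0 h1 l hj
    have hj' : (0 : ℝ) < j := Nat.cast_pos.2 hj
    set B := binomTail lam (l + 1) j
    set σ := lam + (l : ℝ) / j with hσ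
    have hσl : lam ≤ σ := by rw [hσ]; linarith [show (0 : ℝ) ≤ (l : ℝ) / j by positivity]
    have hσ0 : 0 < σ := h0.trans_le hσl
    have h2 : (0 : ℝ) ≤ 1 - ((j + 1 : ℕ) : ℝ) / (n + 1) :=
      sub_nonneg.2 (div_le_one_of_le_succ hjn)
    have h3 := mul_le_mul_of_nonneg_left hr h2
    have h4 : ((j + 1 : ℕ) : ℝ) / (n + 1) * B ≤ ε * (((j + 1 : ℕ) : ℝ) / (n + 1) * B +
        (1 - ((j + 1 : ℕ) : ℝ) / (n + 1)) * (σ * B)) := by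
      refine key.trans ?_
      gcongr
    have h5 : ((j + 1 : ℕ) : ℝ) / (n + 1) ≤ ε * (((j + 1 : ℕ) : ℝ) / (n + 1) +
        (1 - ((j + 1 : ℕ) : ℝ) / (n + 1)) * σ) := by
      refine le_of_mul_le_mul_right (h4.trans_eq ?_) hB
      ring
    set q := ((j + 1 : ℕ) : ℝ) / (n + 1) with hq
    have hq0 : 0 ≤ q := by positivity
    have h6 : q * (lam * slope lam ε) ≤ ε * σ := by
      rw [mul_slope h0]
      have := mul_le_mul_of_nonneg_left hσl (mul_nonneg hq0 hε0.le)
      linarith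
    have h7 : ((j : ℝ) + 1) = q * (n + 1) := by
      rw [hq]
      push_cast
      field_simp
    rw [h7]
    calc q * (n + 1) * (lam / σ) = (n + 1) * (q * (lam * slope lam ε) / (σ * slope lam ε)) := by
          field_simp
      _ ≤ (n + 1) * (ε * σ / (σ * slope lam ε)) := by gcongr
      _ = (n + 1) * (ε / slope lam ε) := by field_simp
  -- With so few variables, the all-ones vector is feasible and makes the confidence limit at least
  -- `1`.
  · exfalso
    have hδ' : δ ≤ lam ^ (n + 1) := hδ.trans (pow_le_pow_of_le_one h0.le h1.le hjn.le)
    have key := (div_weight_le_upperConfidenceLimit (l := l) h0 h1 hδ0 le_rfl hδ').trans h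
    have hB : 0 < binomTail lam (l + 1) n := binomTail_succ_pos h0 h1 l n
    have e : ((n : ℝ) + 1) / (n + 1) = 1 := div_self hn.ne'
    rw [acceptWeight, failWeight, Nat.add_sub_cancel, Nat.cast_add_one, e, sub_self, zero_mul,
      add_zero, one_mul, div_self hB.ne'] at key
    linarith

/-- `κ = (n + 1) ε / slope` is the count with posterior `ε` when the tail ratio is exactly `lam`.
The dual inequality is trivial for `k ≤ (1 - η) κ`; beyond that, the decay of the tail beats `δ`. -/
lemma exists_upperConfidenceLimit_le (h0 : 0 < lam) (h1 : lam < 1) (l : ℕ) {η θ : ℝ}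
    (hη0 : 0 < η) (hη1 : η < 1) (hθ : lam < θ) (hθ1 : θ < 1) :
    ∃ C, 0 < C ∧ ∀ (δ ε : ℝ) (n : ℕ), 0 < δ → δ < 1 → 0 < ε → ε < 1 →
      1 ≤ (n + 1) * (ε / slope lam ε) →
      C * θ ^ ((1 - η) * ((n + 1) * (ε / slope lam ε))) ≤ η * δ →
      upperConfidenceLimit lam l n δ ≤ ε := by
  obtain ⟨C, hC0, hC⟩ := exists_mul_binomTail_le h0 h1 hθ (l + 1)
  refine ⟨C, hC0, fun δ ε n hδ0 hδ1 hε0 hε1 hκ hdec => ?_⟩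
  have hT : 0 < slope lam ε := one_pos.trans_le (one_le_slope h0 h1 hε1)
  have hn : (0 : ℝ) < n + 1 := by positivity
  have hθ0 : 0 < θ := h0.trans hθ
  set κ := ((n : ℝ) + 1) * (ε / slope lam ε) with hκdef
  -- This multiplier moves the sign change of the bound from `k = κ` to `k = (1 - η) κ`.
  refine upperConfidenceLimit_le_of_dual hδ0 hδ1.le (μ := lam * η * ε) (by positivity)
    fun k hk => ?_
  set B := binomTail lam (l + 1) (k - 1) with hB
  have hB0 : 0 ≤ B := binomTail_nonneg h0 h1 _ _
  have hq1 := sub_nonneg.2 (div_le_one_of_le_succ hk)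
  have e1 : lam * B ≤ binomTail lam (l + 1) k := mul_binomTail_pred_le h0 h1 (l + 1) k
  have e2 : acceptWeight lam l n k ≤ B := acceptWeight_le h0 h1 hk
  have e3 : failWeight lam l n k - ε * acceptWeight lam l n k ≤ lam * ε * B * (k / κ - 1) := by
    have e4 := mul_le_mul_of_nonneg_left e1 (mul_nonneg hε0.le hq1)
    have e5 : (k : ℝ) / κ * ε = k / (n + 1) * slope lam ε := by
      rw [hκdef]
      field_simp
    have e6 : lam * ε * B * (k / κ - 1) = k / (n + 1) * (lam * slope lam ε) * B - lam * ε * B := by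
      linear_combination lam * B * e5
    rw [e6, mul_slope h0, acceptWeight, failWeight, ← hB]
    linarith
  have e7 : lam * η * ε * acceptWeight lam l n k ≤ lam * η * ε * B := by gcongr
  have e8 : failWeight lam l n k - (ε - lam * η * ε) * acceptWeight lam l n k ≤
      lam * ε * (B * (k / κ - (1 - η))) := by linarith
  refine e8.trans ?_
  rw [mul_right_comm lam η ε, mul_assoc (lam * ε)]
  refine mul_le_mul_of_nonneg_left ?_ (by positivity)
  have hκ0 : 0 < κ := one_pos.trans_le hκ
  rcases le_or_gt (k : ℝ) ((1 - η) * κ) with hkκ | hkκ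
  · have : (k : ℝ) / κ - (1 - η) ≤ 0 := by
      rw [sub_nonpos, div_le_iff₀ hκ0]
      exact hkκ
    exact (mul_nonpos_of_nonneg_of_nonpos hB0 this).trans (by positivity)
  · have f1 : (k : ℝ) / κ ≤ k := div_le_self k.cast_nonneg hκ
    calc B * (k / κ - (1 - η)) ≤ B * (k + 1) := by
          gcongr
          linarith
      _ = (k + 1) * B := mul_comm _ _
      _ ≤ C * θ ^ k := hC k
      _ ≤ C * θ ^ ((1 - η) * κ) := by
          rw [← Real.rpow_natCast]
          exact mul_le_mul_of_nonneg_left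
            (Real.rpow_le_rpow_of_exponent_ge hθ0 hθ1.le hkκ.le) hC0.le
      _ ≤ η * δ := hdec

/-- Membership is recorded because `sInf ∅ = 0` would make the bound empty of content. -/
lemma exists_minObservations_le (h0 : 0 < lam) (h1 : lam < 1) (l : ℕ) {A : ℝ}
    (hA : 1 / Real.log lam⁻¹ < A) :
    ∃ C, ∀ δ ∈ Ioo (0 : ℝ) 1, ∀ ε ∈ Ioo (0 : ℝ) 1,
      (minObservations lam l ε δ ∈ {n : ℕ | l + 1 ≤ n ∧ upperConfidenceLimit lam l n δ ≤ ε}) ∧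
      minObservations lam l ε δ * (ε / slope lam ε) ≤ A * Real.log δ⁻¹ + C := by
  have hq : 0 < Real.log lam⁻¹ := Real.log_pos ((one_lt_inv₀ h0).2 h1)
  set q := Real.log lam⁻¹ with hqdef
  have hA0 : 0 < A := (one_div_pos.2 hq).trans hA
  set t := 1 / (A * q) with ht
  have ht0 : 0 < t := by positivity
  have ht1 : t < 1 := by
    rw [ht, div_lt_one (by positivity)]
    rwa [div_lt_iff₀ hq] at hA
  -- The slack in `A` is split in two: `r` is used once in `η = 1 - r` and once in `θ = lam ^ r`, so
  -- the decay rate is `q r²`, and `r² ≥ t` gives `q r² ≥ 1 / A`.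
  set r := (1 + t) / 2 with hr
  have hr0 : 0 < r := by positivity
  have hr1 : r < 1 := by rw [hr]; linarith
  have hrt : t ≤ r * r := by rw [hr]; nlinarith [sq_nonneg (1 - t)]
  have hθ1 : lam ^ r < 1 := Real.rpow_lt_one h0.le h1 hr0
  have hθ : lam < lam ^ r := by
    simpa using Real.rpow_lt_rpow_of_exponent_gt h0 h1 hr1
  obtain ⟨C, hC0, hC⟩ := exists_upperConfidenceLimit_le h0 h1 l (sub_pos.2 hr1)
    (show 1 - r < 1 by linarith) hθ hθ1
  set c := |Real.log (C / (1 - r))| with hc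
  refine ⟨A * c + 1 + (l + 2), fun δ ⟨hδ0, hδ1⟩ ε ⟨hε0, hε1⟩ => ?_⟩
  have hx : 0 < Real.log δ⁻¹ := Real.log_pos ((one_lt_inv₀ hδ0).2 hδ1)
  have hT1 := one_le_slope h0 h1 hε1
  have hT : 0 < slope lam ε := one_pos.trans_le hT1
  set D := A * Real.log δ⁻¹ + A * c + 1 with hD
  have hc0 : 0 ≤ c := abs_nonneg _
  have hD1 : 1 ≤ D := by rw [hD]; linarith [mul_pos hA0 hx, mul_nonneg hA0.le hc0]
  have hεT : 0 < ε / slope lam ε := by positivity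
  have hεT1 : ε / slope lam ε ≤ 1 := by
    rw [div_le_one hT]
    linarith
  set n := l + 1 + ⌈D / (ε / slope lam ε)⌉₊ with hn
  have hnD : D ≤ (n + 1) * (ε / slope lam ε) := by
    rw [← div_le_iff₀ hεT]
    have := Nat.le_ceil (D / (ε / slope lam ε))
    rw [hn]
    push_cast
    linarith [show (0 : ℝ) ≤ l from l.cast_nonneg]
  have hmem : n ∈ {n : ℕ | l + 1 ≤ n ∧ upperConfidenceLimit lam l n δ ≤ ε} := by
    refine ⟨by omega, hC δ ε n hδ0 hδ1 hε0 hε1 (hD1.trans hnD) ?_⟩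
    have hν : 0 < 1 - r := sub_pos.2 hr1
    have hlam : lam = Real.exp (-q) := by
      rw [hqdef, Real.log_inv, neg_neg, Real.exp_log h0]
    rw [sub_sub_cancel, ← Real.rpow_mul h0.le, ← div_le_iff₀' hν, mul_div_right_comm]
    have hpos : 0 < C / (1 - r) := by positivity
    generalize ((n : ℝ) + 1) * (ε / slope lam ε) = κ at hnD
    rw [← Real.exp_log hpos, ← Real.exp_log hδ0, hlam, ← Real.exp_mul, ← Real.exp_add,
      Real.exp_le_exp]
    have g1 : Real.log (C / (1 - r)) ≤ c := le_abs_self _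
    have g2 : Real.log δ⁻¹ + c ≤ q * (r * r) * D := by
      have : 1 / A ≤ q * (r * r) := by
        calc 1 / A = q * t := by rw [ht]; field_simp
          _ ≤ q * (r * r) := by gcongr
      calc Real.log δ⁻¹ + c = 1 / A * (A * (Real.log δ⁻¹ + c)) := by field_simp
        _ ≤ 1 / A * D := by
          refine mul_le_mul_of_nonneg_left ?_ (by positivity)
          rw [hD]
          linarith
        _ ≤ q * (r * r) * D := by gcongr
    have g3 : q * (r * r) * D ≤ q * (r * r) * κ := by gcongr
    rw [Real.log_inv] at g2
    linarith
  refine ⟨Nat.sInf_mem ⟨n, hmem⟩, ?_⟩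
  have hle : minObservations lam l ε δ ≤ n := Nat.sInf_le hmem
  calc (minObservations lam l ε δ : ℝ) * (ε / slope lam ε) ≤ n * (ε / slope lam ε) := by gcongr
    _ ≤ (D / (ε / slope lam ε) + (l + 2)) * (ε / slope lam ε) := by
      gcongr
      rw [hn]
      push_cast
      linarith [Nat.ceil_lt_add_one (show 0 ≤ D / (ε / slope lam ε) by positivity)]
    _ = D + (l + 2) * (ε / slope lam ε) := by field_simp
    _ ≤ D + (l + 2) := by
      gcongr
      exact mul_le_of_le_one_right (by positivity) hεT1
    _ = _ := by rw [hD]; ring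

lemma tendsto_log_inv : Tendsto (fun δ : ℝ => Real.log δ⁻¹) (𝓝[>] 0) atTop :=
  Real.tendsto_log_atTop.comp tendsto_inv_nhdsGT_zero

/-- Here `x = ln δ⁻¹` and `j = ⌊x / q⌋₊ - 1`; the final `- 1` pays for replacing `n + 1` by `n`. -/
lemma tendsto_lower_bound (h0 : 0 < lam) (l : ℕ) {q : ℝ} (hq : 0 < q) :
    Tendsto (fun x : ℝ => ((((⌊x / q⌋₊ - 1 : ℕ) : ℝ) + 1) *
      (lam / (lam + l / ((⌊x / q⌋₊ - 1 : ℕ) : ℝ))) - 1) / x) atTop (𝓝 (1 / q)) := by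
  have hdiv : Tendsto (fun x : ℝ => x / q) atTop atTop := tendsto_id.atTop_div_const hq
  have hfl : Tendsto (fun x : ℝ => ⌊x / q⌋₊) atTop atTop := tendsto_nat_floor_atTop.comp hdiv
  have hj : Tendsto (fun x : ℝ => ((⌊x / q⌋₊ - 1 : ℕ) : ℝ)) atTop atTop :=
    tendsto_natCast_atTop_atTop.comp ((tendsto_sub_atTop_nat 1).comp hfl)
  have h1 : Tendsto (fun x : ℝ => lam / (lam + l / ((⌊x / q⌋₊ - 1 : ℕ) : ℝ))) atTop (𝓝 1) := by
    have := (tendsto_const_nhds (x := lam)).div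
      ((tendsto_const_nhds (x := lam)).add (hj.const_div_atTop (l : ℝ)))
      (by rw [add_zero]; exact h0.ne')
    rw [add_zero, div_self h0.ne'] at this
    exact this
  have h2 : Tendsto (fun x : ℝ => (⌊x / q⌋₊ : ℝ) / x) atTop (𝓝 (1 / q)) := by
    have := ((tendsto_nat_floor_div_atTop (R := ℝ)).comp hdiv).mul_const (1 / q)
    rw [one_mul] at this
    refine this.congr' ?_
    filter_upwards [eventually_gt_atTop 0] with x hx
    simp only [Function.comp_apply]
    field_simp
  have h3 := (h2.mul h1).sub (tendsto_id (α := ℝ) (x := atTop)).inv_tendsto_atTop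
  rw [mul_one, sub_zero] at h3
  refine h3.congr' ?_
  filter_upwards [hfl.eventually_ge_atTop 1] with x hx
  rw [Nat.cast_sub hx]
  simp only [Pi.inv_apply, id]
  push_cast
  ring

/-- The number of observations is `slope lam ε / ε * log δ⁻¹ / log lam⁻¹` asymptotically as
`δ → 0`, uniformly in `ε`. -/
lemma tendstoUniformlyOn_minObservations (h0 : 0 < lam) (h1 : lam < 1) (l : ℕ) :
    TendstoUniformlyOn
      (fun δ ε => minObservations lam l ε δ * (ε / slope lam ε) / Real.log δ⁻¹)
      (fun _ => 1 / Real.log lam⁻¹) (𝓝[>] 0) (Ioo 0 1) := by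
  have hq : 0 < Real.log lam⁻¹ := Real.log_pos ((one_lt_inv₀ h0).2 h1)
  rw [Metric.tendstoUniformlyOn_iff]
  intro e he
  obtain ⟨C, hC⟩ := exists_minObservations_le h0 h1 l
    (show 1 / Real.log lam⁻¹ < 1 / Real.log lam⁻¹ + e / 2 by linarith)
  have hlow := ((tendsto_lower_bound h0 l hq).comp tendsto_log_inv).eventually
    (lt_mem_nhds (sub_lt_self _ he))
  have hfl : ∀ᶠ δ : ℝ in 𝓝[>] 0, 2 ≤ ⌊Real.log δ⁻¹ / Real.log lam⁻¹⌋₊ :=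
    (tendsto_nat_floor_atTop.comp (tendsto_log_inv.atTop_div_const hq)).eventually_ge_atTop 2
  filter_upwards [Ioo_mem_nhdsGT one_pos, hlow, hfl,
    tendsto_log_inv.eventually_gt_atTop (C / (e / 2))] with δ hδ hlowδ hflδ hCδ ε hε
  obtain ⟨hmem, hup⟩ := hC δ hδ ε hε
  have hx : 0 < Real.log δ⁻¹ := Real.log_pos ((one_lt_inv₀ hδ.1).2 hδ.2)
  have hT1 := one_le_slope h0 h1 hε.2
  have hεT1 : ε / slope lam ε ≤ 1 := by
    rw [div_le_one (by linarith)]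
    linarith [hε.2]
  set K := ⌊Real.log δ⁻¹ / Real.log lam⁻¹⌋₊ with hK
  have hδK : δ ≤ lam ^ (K - 1 + 1) := by
    rw [Nat.sub_add_cancel (by omega), ← Real.log_le_log_iff hδ.1 (pow_pos h0 K), Real.log_pow]
    have := Nat.floor_le (show 0 ≤ Real.log δ⁻¹ / Real.log lam⁻¹ by positivity)
    rw [← hK, le_div_iff₀ hq, Real.log_inv, Real.log_inv] at this
    linarith
  have hge := le_of_upperConfidenceLimit_le h0 h1 hδ.1 hε.1 hε.2
    (show 0 < K - 1 by omega) hδK hmem.2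
  rw [dist_comm, Real.dist_eq, abs_lt]
  constructor
  · simp only [Function.comp_apply, ← hK] at hlowδ
    have : (((K - 1 : ℕ) : ℝ) + 1) * (lam / (lam + l / ((K - 1 : ℕ) : ℝ))) - 1 ≤
        minObservations lam l ε δ * (ε / slope lam ε) := by linarith
    have := div_le_div_of_nonneg_right this hx.le
    linarith
  · rw [div_lt_iff₀ (by positivity)] at hCδ
    rw [sub_lt_iff_lt_add', div_lt_iff₀ hx]
    linarith

/-! ### Joint and iterated limits, and the optimal `lam` -/

lemma tendsto_slope : Tendsto (slope lam) (𝓝[>] 0) (𝓝 (1 / lam)) := by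
  have h : ContinuousAt (slope lam) 0 := by
    unfold slope
    fun_prop
  have := h.tendsto.mono_left (nhdsWithin_le_nhds (s := Ioi (0 : ℝ)))
  simpa [slope] using this

lemma normalizedN_eq (h0 : 0 < lam) (h1 : lam < 1) (k₀ : ℕ) {ε : ℝ} (hε : ε < 1) (δ : ℝ) :
    normalizedN lam k₀ ε δ = slope lam ε *
      (minObservations lam ⌈(1 - lam) * (k₀ : ℝ)⌉₊ ε δ * (ε / slope lam ε) / Real.log δ⁻¹) := by
  have hT : slope lam ε ≠ 0 := (one_pos.trans_le (one_le_slope h0 h1 hε)).ne'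
  rw [normalizedN, constRegimeN]
  field_simp

lemma tendsto_normalizedN (h0 : 0 < lam) (h1 : lam < 1) (k₀ : ℕ) :
    Tendsto (fun p : ℝ × ℝ => normalizedN lam k₀ p.1 p.2)
      (𝓝[>] (0 : ℝ) ×ˢ 𝓝[>] (0 : ℝ)) (𝓝 (1 / (lam * Real.log lam⁻¹))) := by
  have hε : ∀ᶠ p : ℝ × ℝ in 𝓝[>] (0 : ℝ) ×ˢ 𝓝[>] (0 : ℝ), p.1 ∈ Ioo (0 : ℝ) 1 :=
    tendsto_fst.eventually (Ioo_mem_nhdsGT one_pos)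
  have hX : Tendsto (fun p : ℝ × ℝ => minObservations lam ⌈(1 - lam) * (k₀ : ℝ)⌉₊ p.1 p.2 *
      (p.1 / slope lam p.1) / Real.log p.2⁻¹) (𝓝[>] (0 : ℝ) ×ˢ 𝓝[>] (0 : ℝ))
      (𝓝 (1 / Real.log lam⁻¹)) := by
    rw [Metric.tendsto_nhds]
    intro e he
    have h := Metric.tendstoUniformlyOn_iff.1
      (tendstoUniformlyOn_minObservations h0 h1 ⌈(1 - lam) * (k₀ : ℝ)⌉₊) e he
    filter_upwards [hε, tendsto_snd.eventually h] with p hp hp'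
    rw [dist_comm]
    exact hp' p.1 hp
  have h := ((tendsto_slope (lam := lam)).comp tendsto_fst).mul hX
  rw [one_div_mul_one_div] at h
  refine h.congr' ?_
  filter_upwards [hε] with p hp
  exact (normalizedN_eq h0 h1 k₀ hp.2 p.2).symm

/-- Closed balls survive the inner limit, so the outer limit is found without identifying `G`. -/
lemma tendsto_of_tendsto_prod {α β : Type*} {f : α × β → ℝ} {a : Filter α} {b : Filter β}
    [NeBot a] {c : ℝ} {G : β → ℝ} (hf : Tendsto f (a ×ˢ b) (𝓝 c))
    (hG : ∀ᶠ y in b, Tendsto (fun x => f (x, y)) a (𝓝 (G y))) : Tendsto G b (𝓝 c) := by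
  rw [(Metric.nhds_basis_closedBall).tendsto_right_iff]
  intro e he
  have h := (hf.eventually (Metric.closedBall_mem_nhds c he))
  obtain ⟨pa, hpa, pb, hpb, hp⟩ := eventually_prod_iff.1 h
  filter_upwards [hpb, hG] with y hy hGy
  exact Metric.isClosed_closedBall.mem_of_tendsto hGy (hpa.mono fun x hx => hp hx hy)

lemma exp_one_le_and_eq_iff (h0 : 0 < lam) (h1 : lam < 1) :
    Real.exp 1 ≤ 1 / (lam * Real.log lam⁻¹) ∧
      (1 / (lam * Real.log lam⁻¹) = Real.exp 1 ↔ lam = 1 / Real.exp 1) := by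
  have hq : 0 < Real.log lam⁻¹ := Real.log_pos ((one_lt_inv₀ h0).2 h1)
  set q := Real.log lam⁻¹ with hqdef
  have hlam : lam = Real.exp (-q) := by
    rw [hqdef, Real.log_inv, neg_neg, Real.exp_log h0]
  have hval : 1 / (lam * q) = Real.exp 1 * (Real.exp (q - 1) / q) := by
    rw [hlam, Real.exp_neg, Real.exp_sub]
    field_simp
  have hone : lam = 1 / Real.exp 1 ↔ q = 1 := by
    rw [hlam, one_div, ← Real.exp_neg, Real.exp_eq_exp, neg_inj]
  rw [hval, hone]
  refine ⟨le_mul_of_one_le_right (Real.exp_pos 1).le ?_, fun h => ?_, fun h => ?_⟩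
  · rw [one_le_div hq]
    linarith [Real.add_one_le_exp (q - 1)]
  · by_contra hne
    have h2 := Real.add_one_lt_exp (sub_ne_zero.2 hne)
    have h3 : Real.exp (q - 1) / q = 1 := mul_left_cancel₀ (Real.exp_pos 1).ne' (by rw [h, mul_one])
    rw [div_eq_one_iff_eq hq.ne'] at h3
    linarith
  · rw [h]
    simp

lemma one_div_exp_one_mem : 1 / Real.exp 1 ∈ Ioo (0 : ℝ) 1 := by
  refine ⟨by positivity, ?_⟩
  rw [div_lt_one (Real.exp_pos 1)]
  exact Real.one_lt_exp_iff.2 one_pos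

end RandomizedTest

end

theorem mainTheorem11 (k₀ : ℕ) :
    -- the limit: jointly in `(ε, δ)`, and as an iterated limit in both orders
    (∀ lam ∈ Ioo (0 : ℝ) 1,
      Tendsto (fun p : ℝ × ℝ => RandomizedTest.normalizedN lam k₀ p.1 p.2)
          (𝓝[>] (0 : ℝ) ×ˢ 𝓝[>] (0 : ℝ)) (𝓝 (1 / (lam * Real.log lam⁻¹))) ∧
      (∃ F : ℝ → ℝ,
        (∀ ε ∈ Ioo (0 : ℝ) 1,
          Tendsto (fun δ => RandomizedTest.normalizedN lam k₀ ε δ) (𝓝[>] 0) (𝓝 (F ε))) ∧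
        Tendsto F (𝓝[>] 0) (𝓝 (1 / (lam * Real.log lam⁻¹)))) ∧
      (∃ G : ℝ → ℝ,
        (∀ δ ∈ Ioo (0 : ℝ) 1,
          Tendsto (fun ε => RandomizedTest.normalizedN lam k₀ ε δ) (𝓝[>] 0) (𝓝 (G δ))) ∧
        Tendsto G (𝓝[>] 0) (𝓝 (1 / (lam * Real.log lam⁻¹))))) ∧
    -- the limit value is minimal, with value `e`, exactly at `1 / e`
    (∀ lam ∈ Ioo (0 : ℝ) 1,
      Real.exp 1 ≤ 1 / (lam * Real.log lam⁻¹) ∧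
      (1 / (lam * Real.log lam⁻¹) = Real.exp 1 ↔ lam = 1 / Real.exp 1)) ∧
    -- hence `1 / e` needs fewer observations than any other choice, for small `ε` and `δ`
    (∀ lam ∈ Ioo (0 : ℝ) 1, lam ≠ 1 / Real.exp 1 →
      ∀ᶠ p : ℝ × ℝ in 𝓝[>] (0 : ℝ) ×ˢ 𝓝[>] (0 : ℝ),
        RandomizedTest.constRegimeN (1 / Real.exp 1) k₀ p.1 p.2 <
          RandomizedTest.constRegimeN lam k₀ p.1 p.2) := by
  have joint := fun lam (hlam : lam ∈ Ioo (0 : ℝ) 1) =>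
    RandomizedTest.tendsto_normalizedN hlam.1 hlam.2 k₀
  refine ⟨fun lam hlam => ⟨joint lam hlam, ?_, ?_⟩,
    fun lam hlam => RandomizedTest.exp_one_le_and_eq_iff hlam.1 hlam.2, fun lam hlam hne => ?_⟩
  · refine ⟨fun ε => RandomizedTest.slope lam ε * (1 / Real.log lam⁻¹), fun ε hε => ?_, ?_⟩
    · simp only [RandomizedTest.normalizedN_eq hlam.1 hlam.2 k₀ hε.2]
      exact ((RandomizedTest.tendstoUniformlyOn_minObservations hlam.1 hlam.2 _).tendsto_at
        hε).const_mul _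
    · have h := (RandomizedTest.tendsto_slope (lam := lam)).mul_const (1 / Real.log lam⁻¹)
      rwa [one_div_mul_one_div] at h
  · have h : ∀ δ ∈ Ioo (0 : ℝ) 1, ∃ M,
        Tendsto (fun ε => RandomizedTest.normalizedN lam k₀ ε δ) (𝓝[>] 0) (𝓝 M) := by
      intro δ hδ
      obtain ⟨M, hM⟩ := RandomizedTest.exists_tendsto_mul_minObservations hlam.1 hlam.2
        ⌈(1 - lam) * (k₀ : ℝ)⌉₊ hδ.1 hδ.2
      exact ⟨M / Real.log δ⁻¹, hM.div_const _⟩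
    choose! G hG using h
    refine ⟨G, hG, RandomizedTest.tendsto_of_tendsto_prod (joint lam hlam) ?_⟩
    filter_upwards [Ioo_mem_nhdsGT one_pos] with δ hδ using hG δ hδ
  · have he := RandomizedTest.one_div_exp_one_mem
    have hlim := joint _ he
    rw [(RandomizedTest.exp_one_le_and_eq_iff he.1 he.2).2.2 rfl] at hlim
    obtain ⟨hle, heq⟩ := RandomizedTest.exp_one_le_and_eq_iff hlam.1 hlam.2
    -- The limits differ strictly, so the normalized numbers are eventually ordered; the common
    -- factor `ε / ln δ⁻¹` then cancels.
    have hlt := lt_of_le_of_ne hle fun h => hne (heq.1 h.symm)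
    filter_upwards [hlim.eventually_lt (joint lam hlam) hlt,
      tendsto_fst.eventually (Ioo_mem_nhdsGT one_pos),
      tendsto_snd.eventually (Ioo_mem_nhdsGT one_pos)] with p hp hε hδ
    have hx : 0 < Real.log p.2⁻¹ := Real.log_pos ((one_lt_inv₀ hδ.1).2 hδ.2)
    rw [RandomizedTest.normalizedN, RandomizedTest.normalizedN,
      div_lt_div_iff_of_pos_right hx, mul_lt_mul_iff_right₀ hε.1] at hp
    exact_mod_cast hp
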